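/- **Setting.** Let $J$, $M$, $R$ be finite sets of jobs, machines and routines; every routine $r\in R$ has one job $\mathrm{job}(r)\in J$ and a set of machines $M(r)\subseteq M$. Let $\Delta$ be the maximum, over jobs $u$, of the number of routines $r$ with $\mathrm{job}(r)=u$. When a machine $x$ is deleted, all routines $r$ with $x\in M(r)$ are deleted. An assignment gives each job $u$ at most one routine for $u$; the load of a machine $x$ is the number of assigned routines $r$ with $x\in M(r)$. $\mathrm{Resample}(u)$ discards the routine of $u$ and assigns to $u$ a uniformly random one of the remaining (not deleted) routines for $u$, if there is one, independently of everything else. **Process.** Let $T\le|M|$ be the total number of machine deletions. At timestep $0$ every job is resampled; let $F^0$ be the set of assigned routines. At each timestep $t=1,\dots,T$: (i) $\mathrm{Resample}(u)$ is called for every job $u$ with $t\in\mathrm{Schedule}(u)$ (all schedules are initially empty); (ii) an adversary, which may be randomized and knows everything that happened so far, including the outcome of (i), deletes a machine $x^t$; (iii) for every job $u$ whose assigned routine is thereby deleted, $\mathrm{Resample}(u)$ is called and all numbers $t+2^i\le T$ with $i\ge 0$ are added to $\mathrm{Schedule}(u)$. Let $F^t$ be the set of assigned routines after (iii). The recourse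 at timestep $t$ is $|F^t\setminus F^{t-1}|$, and the total recourse is $\sum_{t=1}^T|F^t\setminus F^{t-1}|$. **Lemma.** 1. For every $c\in\mathbb N$ there is a constant $C>0$, depending only on $c$, such that for every such instance and every adaptive adversary, with probability at least $1-|M|^{-c}$ the total recourse is at most $$C\left(|J|\,\log(\Delta)\,\log^2|M| + T\log^2|M|\right),$$ where $\log 0$ is read as $0$. 2. There is an absolute constant $C>0$ such that, if $T\ge 2$, then for every such instance, every adaptive adversary, every $\lambda\in\mathbb{R}$ and every outcome of positive probability in which all machine loads are at most $\lambda$ whenever the adversary is about to delete a machine (that is, between (i) and (ii) of each timestep $1,\dots,T$), the recourse at every timestep $t\in\{1,\dots,T\}$ is at most $C\,\lambda\log T$. -/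

import Mathlib

namespace JobMachine

noncomputable section

/-- The hypergraph of jobs `J`, machines `M` and routines `R`: every routine is a hyperedge made of
exactly one job and a finite set of machines. -/
structure Graph (J M R : Type*) where
  job : R → J
  machines : R → Finset M

/-- For every job, the routine that currently handles it, if any. -/
abbrev Assignment (J R : Type*) := J → Option R

/-- A record of a run. `start A` is the time right after the initialization with assignment `A`.
`step h B x A` continues `h` by one timestep, in which `B` is the assignment after the scheduled
resampling (the one which the adversary faces), `x` is the machine that the adversary deletes,
and `A` is the assignment at the end of the timestep. -/
inductive History (J M R : Type*) where
  | start (A : Assignment J R) : History J M R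
  | step (h : History J M R) (B : Assignment J R) (x : M) (A : Assignment J R) : History J M R

namespace History

variable {J M R : Type*}

/-- The number of completed timesteps. -/
def length : History J M R → ℕ
  | start _ => 0
  | step h _ _ _ => h.length + 1

/-- The assignment at the end of the last completed timestep. -/
def current : History J M R → Assignment J R
  | start A => A
  | step _ _ _ A => A

open Classical in
/-- The set of machines deleted so far. -/
def deleted : History J M R → Finset M
  | start _ => ∅
  | step h _ x _ => insert x h.deleted

/-- The assignment after `t` machine deletions, for `t ≤ h.length`. -/
def assignmentAt : History J M R → ℕ → Assignment J R
  | start A, _ => A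
  | step h _ _ A, t => if t ≤ h.length then h.assignmentAt t else A

/-- The assignment which the adversary faces at timestep `t`, just before it deletes its `t`-th
machine, for `1 ≤ t ≤ h.length`. -/
def facedAt : History J M R → ℕ → Assignment J R
  | start A, _ => A
  | step h B _ _, t => if t ≤ h.length then h.facedAt t else B

end History

/-- An adaptive adversary, possibly randomized: at each timestep it sees everything that has
happened so far, including the outcome of the scheduled resampling of this timestep, and then
names the machine to be deleted. (Naming a machine that is already deleted changes nothing.) -/
abbrev Adversary (J M R : Type*) := History J M R → Assignment J R → PMF M

namespace Graph

variable {J M R : Type*} [Fintype J] [Fintype R] (G : Graph J M R)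

open Classical in
/-- The routines for job `u` that contain no machine of `D`. -/
def routinesFor (D : Finset M) (u : J) : Finset R :=
  Finset.univ.filter fun r => G.job r = u ∧ Disjoint (G.machines r) D

/-- The maximum degree of a job in the initial graph. -/
def maxDegree : ℕ :=
  Finset.univ.sup fun u => (G.routinesFor ∅ u).card

open Classical in
/-- The routines used by an assignment. -/
def edges (A : Assignment J R) : Finset R :=
  Finset.univ.filter fun r => A (G.job r) = some r

open Classical in
/-- The number of routines of the assignment that involve machine `x`. -/
def load (A : Assignment J R) (x : M) : ℕ :=
  ((G.edges A).filter fun r => x ∈ G.machines r).card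

open Classical in
/-- The jobs that are touched when machine `x` is deleted while the assignment is `B`. -/
def touched (B : Assignment J R) (x : M) : Finset J :=
  Finset.univ.filter fun u => ∃ r, B u = some r ∧ x ∈ G.machines r

open Classical in
/-- The possible values of the new assignment at job `u` when the jobs in `U` are resampled and the
machines in `D` are deleted: a job in `U` gets one of its remaining routines (none if there are
none left), any other job keeps what it has. -/
def options (D : Finset M) (U : Finset J) (A : Assignment J R) (u : J) : Finset (Option R) :=
  if u ∈ U then
    if (G.routinesFor D u).Nonempty then (G.routinesFor D u).image some else {none}
  else {A u}

open Classical in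
theorem options_nonempty (D : Finset M) (U : Finset J) (A : Assignment J R) (u : J) :
    (G.options D U A u).Nonempty := by
  unfold options
  split_ifs with h1 h2
  · exact h2.image _
  · exact Finset.singleton_nonempty _
  · exact Finset.singleton_nonempty _

open Classical in
/-- Resample all jobs in `U`, each one independently and uniformly from its remaining routines;
the joint law of these independent uniform choices is the uniform law on the product. -/
def resample (D : Finset M) (U : Finset J) (A : Assignment J R) : PMF (Assignment J R) :=
  PMF.uniformOfFinset (Fintype.piFinset (G.options D U A))
    (Fintype.piFinset_nonempty.mpr (G.options_nonempty D U A))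

open Classical in
/-- The schedule of job `u` after the history: whenever `u` is touched at a timestep `t`, all
`s = t + 2 ^ i` with `s ≤ T` are put into it. -/
def schedule (T : ℕ) : History J M R → J → Finset ℕ
  | .start _, _ => ∅
  | .step h B x _, u => schedule T h u ∪
      if u ∈ G.touched B x then
        (Finset.Icc 1 T).filter fun s => ∃ i : ℕ, s = (h.length + 1) + 2 ^ i
      else ∅

open Classical in
/-- One timestep `t` of proactive resampling against the adversary: resample all jobs that have `t`
in their schedule, let the adversary delete a machine `x`, resample all touched jobs. -/
def nextStep (T : ℕ) (adv : Adversary J M R) (h : History J M R) : PMF (History J M R) :=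
  (G.resample h.deleted (Finset.univ.filter fun u => h.length + 1 ∈ G.schedule T h u)
      h.current).bind fun B =>
    (adv h B).bind fun x =>
      (G.resample (insert x h.deleted) (G.touched B x) B).map fun A => .step h B x A

/-- The law of the history after `n` timesteps, when the total number of deletions is `T`. At
timestep `0` all jobs are resampled. -/
def run (T : ℕ) (adv : Adversary J M R) : ℕ → PMF (History J M R)
  | 0 => (G.resample ∅ Finset.univ fun _ => none).map .start
  | n + 1 => (run T adv n).bind (G.nextStep T adv)

open Classical in
/-- The recourse at timestep `t ≥ 1`: the number of routines that are in the assignment after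
`t` deletions but not in the one after `t - 1` deletions. -/
def recourse (h : History J M R) (t : ℕ) : ℕ :=
  (G.edges (h.assignmentAt t) \ G.edges (h.assignmentAt (t - 1))).card

/-- The total recourse during the timesteps `1, …, T`. -/
def totalRecourse (T : ℕ) (h : History J M R) : ℕ :=
  ∑ t ∈ Finset.Icc 1 T, G.recourse h t

end Graph

end

end JobMachine

/-!
The recourse of a timestep is at most the number of jobs resampled in it, and a job is resampled
only because it has just been touched or because it was touched `2 ^ i` timesteps earlier. For the
second claim, each of these `O(log T)` groups of jobs has at most `lam` members, since the jobs
touched by a deletion are counted by the load of the deleted machine (`IsRun.recourse_le`).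

For the first claim it remains to bound the total number of touches by
`O(|J| log Δ log |M| + T log |M|)`; the total recourse is then at most `log T + 2` times as large
(`IsRun.totalRecourse_le`). The adversary is adaptive, so the whole sequence `σ` of deleted machines
is fixed in advance, and all `|M| ^ T` sequences are considered at once: this costs `T log |M|` in
the exponent, which the bound allows for. When job `u` is resampled by schedule at time `s`, its
schedule already contains the next resampling time `e`; the resampling is a hit if the new routine
is deleted by `σ` during the window `[s, e)`.

* Every touch of a job but the first is charged to a hit, provided that `σ` is the true deletion
  sequence (`IsRun.touchCount_le`). A touch cannot find a routine picked in reaction to an earlier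
  touch, as the job is resampled by schedule before the next deletion.
* Given the past, hits of different jobs are independent, and the probability of a hit (`hitProb`)
  is known. So the product over all jobs of `exp (hits - 2 * risk)`, where `risk` is the sum of
  these probabilities, is a supermartingale (`tsum_run_mul_potential_le_one`).
* For the true deletion sequence, `hitProb` is the fraction of routines lost during the window, so
  that over disjoint windows it sums to at most `1 + log Δ`. The windows of one job are laminar: a
  window opened inside another one follows a touch inside that one, and the exponential schedule
  makes it at most half as long. Hence the risk of a job is at most
  `(log T + 1) * (1 + log Δ)` (`IsRun.risk_le`).

Markov's inequality for the sum of the potentials over all `σ` gives the claim. If `Δ ≤ 1`, then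
`log Δ = 0`, but no routine is ever new (`IsRun.recourse_eq_zero`).
-/

namespace JobMachine

noncomputable section

open scoped Classical ENNReal

set_option linter.unusedSectionVars false

variable {J M R : Type*} [Fintype J] [Fintype R]

namespace History

/-! ### Histories and deletion sequences -/

theorem assignmentAt_length (h : History J M R) : h.assignmentAt h.length = h.current := by
  cases h <;> simp [assignmentAt, current, length]

/-- The history deletes the machines `σ 1, σ 2, …` in this order. -/
def Follows (σ : ℕ → M) : History J M R → Prop
  | start _ => True
  | step h _ x _ => h.Follows σ ∧ σ (h.length + 1) = x

theorem follows_congr {σ τ : ℕ → M} {h : History J M R} (hh : h.Follows σ)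
    (hστ : ∀ t ∈ Finset.Icc 1 h.length, σ t = τ t) : h.Follows τ := by
  induction h with
  | start A => trivial
  | step h B x A ih =>
    simp only [length] at hστ
    refine ⟨ih hh.1 fun t ht => hστ t ?_, ?_⟩
    · rw [Finset.mem_Icc] at ht ⊢; omega
    · rw [← hστ _ (by simp)]; exact hh.2

theorem exists_follows [Nonempty M] (h : History J M R) : ∃ σ : ℕ → M, h.Follows σ := by
  induction h with
  | start A => exact ⟨fun _ => Classical.arbitrary M, trivial⟩
  | step h B x A ih =>
    obtain ⟨σ, hσ⟩ := ih
    refine ⟨Function.update σ (h.length + 1) x, follows_congr hσ fun t ht => ?_, by simp⟩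
    rw [Function.update_of_ne]
    rw [Finset.mem_Icc] at ht; omega

theorem Follows.deleted_eq {σ : ℕ → M} {h : History J M R} (hh : h.Follows σ) :
    h.deleted = (Finset.Ico 1 (h.length + 1)).image σ := by
  induction h with
  | start A => simp [deleted, length]
  | step h B x A ih =>
    rw [deleted, ih hh.1, length, ← hh.2, ← Finset.image_insert,
      Finset.insert_Ico_right_eq_Ico_add_one (by omega)]

end History

namespace Graph

variable (G : Graph J M R)

/-! ### Runs of the process -/

/-- The histories that the process can produce: every job which is resampled takes one of its
options, every other job keeps its routine. The choices of the adversary are arbitrary. -/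
inductive IsRun (T : ℕ) : History J M R → Prop
  | start (A : Assignment J R) (hA : ∀ u, A u ∈ G.options ∅ Finset.univ (fun _ => none) u) :
      IsRun T (.start A)
  | step (h : History J M R) (B : Assignment J R) (x : M) (A : Assignment J R)
      (hh : IsRun T h) (hlt : h.length < T)
      (hB : ∀ u, B u ∈ G.options h.deleted
        (Finset.univ.filter fun u => h.length + 1 ∈ G.schedule T h u) h.current u)
      (hA : ∀ u, A u ∈ G.options (insert x h.deleted) (G.touched B x) B u) :
      IsRun T (.step h B x A)

theorem mem_support_resample {D : Finset M} {U : Finset J} {A B : Assignment J R} :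
    B ∈ (G.resample D U A).support ↔ ∀ u, B u ∈ G.options D U A u := by
  simp [resample]

theorem isRun_of_mem_support {T : ℕ} {adv : Adversary J M R} {n : ℕ} (hn : n ≤ T)
    {h : History J M R} (hh : h ∈ (G.run T adv n).support) : G.IsRun T h ∧ h.length = n := by
  induction n generalizing h with
  | zero =>
    rw [run, PMF.mem_support_map_iff] at hh
    obtain ⟨A, hA, rfl⟩ := hh
    exact ⟨.start A ((G.mem_support_resample).1 hA), rfl⟩
  | succ n ih =>
    rw [run, PMF.mem_support_bind_iff] at hh
    obtain ⟨h', hh', hh⟩ := hh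
    rw [nextStep, PMF.mem_support_bind_iff] at hh
    obtain ⟨B, hB, hh⟩ := hh
    rw [PMF.mem_support_bind_iff] at hh
    obtain ⟨x, -, hh⟩ := hh
    rw [PMF.mem_support_map_iff] at hh
    obtain ⟨A, hA, rfl⟩ := hh
    obtain ⟨h1, h2⟩ := ih (by omega) hh'
    exact ⟨.step h' B x A h1 (by omega) ((G.mem_support_resample).1 hB)
      ((G.mem_support_resample).1 hA), by simp [History.length, h2]⟩

variable {G}

theorem mem_routinesFor {D : Finset M} {u : J} {r : R} :
    r ∈ G.routinesFor D u ↔ G.job r = u ∧ Disjoint (G.machines r) D := by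
  simp [routinesFor]

theorem routinesFor_antitone {D D' : Finset M} (hD : D ⊆ D') (u : J) :
    G.routinesFor D' u ⊆ G.routinesFor D u := fun r hr => by
  rw [mem_routinesFor] at hr ⊢
  exact ⟨hr.1, hr.2.mono_right hD⟩

theorem card_routinesFor_le_maxDegree (D : Finset M) (u : J) :
    (G.routinesFor D u).card ≤ G.maxDegree :=
  (Finset.card_le_card (routinesFor_antitone (Finset.empty_subset D) u)).trans
    (Finset.le_sup (f := fun u => (G.routinesFor ∅ u).card) (Finset.mem_univ u))

theorem mem_touched {B : Assignment J R} {x : M} {u : J} :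
    u ∈ G.touched B x ↔ ∃ r, B u = some r ∧ x ∈ G.machines r := by
  simp [touched]

theorem eq_of_mem_options_of_notMem {D : Finset M} {U : Finset J} {A : Assignment J R} {u : J}
    {o : Option R} (ho : o ∈ G.options D U A u) (hu : u ∉ U) : o = A u := by
  simpa [options, hu] using ho

theorem mem_routinesFor_of_mem_options {D : Finset M} {U : Finset J} {A : Assignment J R} {u : J}
    {r : R} (ho : some r ∈ G.options D U A u) (hu : u ∈ U) : r ∈ G.routinesFor D u := by
  rw [options, if_pos hu] at ho
  split_ifs at ho
  · simpa using ho
  · simp at ho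

/-- Every assigned routine is a remaining routine of the job it is assigned to. -/
theorem IsRun.mem_routinesFor_current {T : ℕ} {h : History J M R} (hh : G.IsRun T h) {u : J}
    {r : R} (hr : h.current u = some r) : r ∈ G.routinesFor h.deleted u := by
  induction hh generalizing r with
  | start A hA =>
    have := hA u
    simp only [History.current] at hr
    rw [hr] at this
    exact mem_routinesFor_of_mem_options this (Finset.mem_univ u)
  | step h B x A hh hlt hB hA ih =>
    simp only [History.current] at hr
    have h1 := hA u
    rw [hr] at h1
    by_cases hu : u ∈ G.touched B x
    · exact mem_routinesFor_of_mem_options h1 hu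
    · have h2 := eq_of_mem_options_of_notMem h1 hu
      have h3 : r ∈ G.routinesFor h.deleted u := by
        have h4 := hB u
        rw [← h2] at h4
        by_cases hs : u ∈ Finset.univ.filter fun u => h.length + 1 ∈ G.schedule T h u
        · exact mem_routinesFor_of_mem_options h4 hs
        · exact ih (eq_of_mem_options_of_notMem h4 hs).symm
      rw [mem_routinesFor] at h3 ⊢
      refine ⟨h3.1, ?_⟩
      have h5 : x ∉ G.machines r := fun hx => hu (mem_touched.2 ⟨r, h2.symm, hx⟩)
      simp only [History.deleted]
      exact Finset.disjoint_insert_right.2 ⟨h5, h3.2⟩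

/-- The assignment that the adversary faces assigns to every job a remaining routine of it. -/
theorem IsRun.mem_routinesFor_faced {T : ℕ} {h : History J M R} (hh : G.IsRun T h)
    {B : Assignment J R} (hB : ∀ u, B u ∈ G.options h.deleted
      (Finset.univ.filter fun u => h.length + 1 ∈ G.schedule T h u) h.current u) {u : J}
    {r : R} (hr : B u = some r) : r ∈ G.routinesFor h.deleted u := by
  have h4 := hB u
  by_cases hs : u ∈ Finset.univ.filter fun u => h.length + 1 ∈ G.schedule T h u
  · exact mem_routinesFor_of_mem_options (hr ▸ h4) hs
  · exact hh.mem_routinesFor_current ((eq_of_mem_options_of_notMem h4 hs).symm.trans hr)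

theorem card_touched_le_load {B : Assignment J R} (hB : ∀ u r, B u = some r → G.job r = u) (x : M) :
    (G.touched B x).card ≤ G.load B x := by
  rw [load]
  refine Finset.card_le_card_of_surjOn G.job fun u hu => ?_
  obtain ⟨r, hr, hx⟩ := mem_touched.1 hu
  have hj := hB u r hr
  exact ⟨r, by simp [edges, hj, hr, hx], hj⟩

/-! ### Schedules -/

theorem mem_schedule_step {T : ℕ} {h : History J M R} {B A : Assignment J R} {x : M} {u : J}
    {s : ℕ} : s ∈ G.schedule T (.step h B x A) u ↔ s ∈ G.schedule T h u ∨
      u ∈ G.touched B x ∧ s ≤ T ∧ ∃ i : ℕ, s = h.length + 1 + 2 ^ i := by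
  rw [schedule, Finset.mem_union]
  refine or_congr_right ?_
  split_ifs with hu
  · simp only [Finset.mem_filter, Finset.mem_Icc, hu, true_and]
    refine and_congr_left fun ⟨i, hi⟩ => ?_
    generalize 2 ^ i = p at hi
    omega
  · simp [hu]

/-- At most `log T + 1` positive numbers differ from `s ≤ T` by a power of two. -/
theorem card_filter_add_two_pow_le {T s : ℕ} (hs : s ≤ T) (n : ℕ) :
    ((Finset.Icc 1 n).filter fun t => ∃ i : ℕ, s = t + 2 ^ i).card ≤ Nat.log 2 T + 1 := by
  calc _ ≤ ((Finset.range (Nat.log 2 T + 1)).image fun i => s - 2 ^ i).card := by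
        refine Finset.card_le_card fun t ht => ?_
        simp only [Finset.mem_filter, Finset.mem_Icc] at ht
        obtain ⟨ht, i, hi⟩ := ht
        refine Finset.mem_image.2 ⟨i, ?_, by generalize 2 ^ i = p at hi; omega⟩
        rw [Finset.mem_range, Nat.lt_succ_iff]
        exact Nat.le_log_of_pow_le (by norm_num) (by generalize 2 ^ i = p at hi ⊢; omega)
    _ ≤ _ := Finset.card_image_le.trans (by simp)

/-! ### Recourse -/

/-- A routine that is new in timestep `t` belongs to a job that was resampled in timestep `t`,
either by schedule or because it was touched. -/
theorem card_edges_sdiff_le {T : ℕ} {h : History J M R} {B A : Assignment J R} {x : M}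
    (hB : ∀ u, B u ∈ G.options h.deleted
      (Finset.univ.filter fun u => h.length + 1 ∈ G.schedule T h u) h.current u)
    (hA : ∀ u, A u ∈ G.options (insert x h.deleted) (G.touched B x) B u) :
    (G.edges A \ G.edges h.current).card ≤
      (Finset.univ.filter fun u => h.length + 1 ∈ G.schedule T h u).card +
        (G.touched B x).card := by
  have hinj : Set.InjOn G.job (G.edges A \ G.edges h.current : Finset R) := by
    intro r hr r' hr' hrr
    simp only [edges, Finset.coe_sdiff, Finset.coe_filter, Set.mem_sdiff, Set.mem_ofPred_eq,
      Finset.mem_univ, true_and] at hr hr'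
    have := hr.1.symm.trans ((congrArg A hrr).trans hr'.1)
    exact Option.some_injective _ this
  rw [← Finset.card_image_of_injOn hinj]
  refine (Finset.card_le_card ?_).trans (Finset.card_union_le _ _)
  intro u hu
  obtain ⟨r, hr, rfl⟩ := Finset.mem_image.1 hu
  simp only [edges, Finset.mem_sdiff, Finset.mem_filter, Finset.mem_univ, true_and] at hr
  by_contra hcon
  rw [Finset.mem_union, not_or] at hcon
  have h1 := eq_of_mem_options_of_notMem (hA (G.job r)) hcon.2
  have h2 := eq_of_mem_options_of_notMem (hB (G.job r)) (by simpa using hcon.1)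
  exact hr.2 (by rw [← h2, ← h1, hr.1])

theorem recourse_step_of_le {h : History J M R} {B A : Assignment J R} {x : M} {t : ℕ}
    (ht : t ≤ h.length) : G.recourse (.step h B x A) t = G.recourse h t := by
  have h1 : t - 1 ≤ h.length := by omega
  simp [recourse, History.assignmentAt, ht, h1]

theorem recourse_step_length {h : History J M R} {B A : Assignment J R} {x : M} :
    G.recourse (.step h B x A) (h.length + 1) = (G.edges A \ G.edges h.current).card := by
  simp [recourse, History.assignmentAt, History.assignmentAt_length]

/-- If all faced loads are at most `lam`, then the jobs scheduled at time `s` were touched at one of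
the times `s - 2 ^ i`, at most `lam` of them at each of these times. -/
theorem IsRun.card_scheduled_le {T : ℕ} {h : History J M R} (hh : G.IsRun T h) {lam : ℝ}
    (hlam : ∀ t ∈ Finset.Icc 1 h.length, ∀ x, (G.load (h.facedAt t) x : ℝ) ≤ lam) (s : ℕ) :
    ((Finset.univ.filter fun u => s ∈ G.schedule T h u).card : ℝ) ≤
      ((Finset.Icc 1 h.length).filter fun t => ∃ i : ℕ, s = t + 2 ^ i).card * lam := by
  induction hh with
  | start A hA => simp [schedule, History.length]
  | step h B x A hh hlt hB hA ih =>
    have ih := ih fun t ht x => by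
      have h1 := hlam t (by simp only [History.length, Finset.mem_Icc] at ht ⊢; omega) x
      simpa [History.facedAt, (Finset.mem_Icc.1 ht).2] using h1
    have hx := hlam (h.length + 1) (by simp [History.length]) x
    simp only [History.facedAt, Nat.not_succ_le_self, if_false] at hx
    have htl : ((G.touched B x).card : ℝ) ≤ lam := le_trans (by
      exact_mod_cast card_touched_le_load (fun u r hr =>
        (mem_routinesFor.1 (hh.mem_routinesFor_faced hB hr)).1) x) hx
    simp only [mem_schedule_step, History.length]
    rw [← Finset.insert_Icc_right_eq_Icc_add_one (by omega), Finset.filter_insert]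
    split_ifs with hs
    · rw [Finset.card_insert_of_notMem (by simp)]
      calc _ ≤ (((Finset.univ.filter fun u => s ∈ G.schedule T h u) ∪ G.touched B x).card : ℝ) := by
            norm_cast
            refine Finset.card_le_card fun u hu => ?_
            simp only [Finset.mem_filter, Finset.mem_univ, true_and, Finset.mem_union] at hu ⊢
            exact hu.imp_right fun h => h.1
        _ ≤ ((Finset.univ.filter fun u => s ∈ G.schedule T h u).card : ℝ) +
            (G.touched B x).card := by exact_mod_cast Finset.card_union_le _ _
        _ ≤ _ := by push_cast; linarith
    · refine le_trans (le_of_eq ?_) ih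
      simp [hs]

theorem IsRun.recourse_le {T : ℕ} {h : History J M R} (hh : G.IsRun T h) {lam : ℝ}
    (hlam : ∀ t ∈ Finset.Icc 1 h.length, ∀ x, (G.load (h.facedAt t) x : ℝ) ≤ lam) {t : ℕ}
    (ht : t ∈ Finset.Icc 1 h.length) :
    (G.recourse h t : ℝ) ≤ (Nat.log 2 T + 2) * lam := by
  induction hh with
  | start A hA => simp [History.length] at ht
  | step h B x A hh hlt hB hA ih =>
    have hlam' : ∀ t ∈ Finset.Icc 1 h.length, ∀ x, (G.load (h.facedAt t) x : ℝ) ≤ lam := by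
      intro t ht x
      have h1 := hlam t (by simp only [History.length, Finset.mem_Icc] at ht ⊢; omega) x
      simpa [History.facedAt, (Finset.mem_Icc.1 ht).2] using h1
    by_cases htn : t ≤ h.length
    · rw [recourse_step_of_le htn]
      exact ih hlam' (Finset.mem_Icc.2 ⟨(Finset.mem_Icc.1 ht).1, htn⟩)
    · obtain rfl : t = h.length + 1 := by
        simp only [History.length, Finset.mem_Icc] at ht; omega
      have hx := hlam (h.length + 1) (by simp [History.length]) x
      simp only [History.facedAt, Nat.not_succ_le_self, if_false] at hx
      have htl : ((G.touched B x).card : ℝ) ≤ lam := le_trans (by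
        exact_mod_cast card_touched_le_load (fun u r hr =>
          (mem_routinesFor.1 (hh.mem_routinesFor_faced hB hr)).1) x) hx
      have hlam0 : 0 ≤ lam := le_trans (Nat.cast_nonneg _) hx
      have h1 : ((G.edges A \ G.edges h.current).card : ℝ) ≤
          (Finset.univ.filter fun u => h.length + 1 ∈ G.schedule T h u).card +
            (G.touched B x).card := by exact_mod_cast card_edges_sdiff_le hB hA
      have h2 := hh.card_scheduled_le hlam' (h.length + 1)
      have h3 : (((Finset.Icc 1 h.length).filter fun t => ∃ i : ℕ,
          h.length + 1 = t + 2 ^ i).card : ℝ) ≤ Nat.log 2 T + 1 := by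
        exact_mod_cast card_filter_add_two_pow_le (T := T) hlt h.length
      rw [recourse_step_length]
      have h4 := mul_le_mul_of_nonneg_right h3 hlam0
      linarith

/-- With at most one routine per job there is never a new routine: a job that has a remaining
routine is assigned that routine. -/
theorem IsRun.recourse_eq_zero {T : ℕ} {h : History J M R} (hh : G.IsRun T h)
    (hdeg : G.maxDegree ≤ 1) {t : ℕ} (ht : t ∈ Finset.Icc 1 h.length) : G.recourse h t = 0 := by
  have huniq : ∀ (D : Finset M) (U : Finset J) (A : Assignment J R) (u : J) (r : R),
      u ∈ U → r ∈ G.routinesFor D u → ∀ o ∈ G.options D U A u, o = some r := by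
    intro D U A u r hu hr o ho
    rw [options, if_pos hu, if_pos ⟨r, hr⟩] at ho
    obtain ⟨r', hr', rfl⟩ := Finset.mem_image.1 ho
    rw [Finset.card_le_one.1 ((card_routinesFor_le_maxDegree D u).trans hdeg) r' hr' r hr]
  have hcur : ∀ h : History J M R, G.IsRun T h → ∀ u, ∀ r ∈ G.routinesFor h.deleted u,
      h.current u = some r := by
    intro h hh
    induction hh with
    | start A hA => exact fun u r hr => huniq _ _ _ u r (Finset.mem_univ u) hr _ (hA u)
    | step h B x A hh hlt hB hA ih =>
      intro u r hr
      simp only [History.current]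
      by_cases hu : u ∈ G.touched B x
      · exact huniq _ _ _ u r hu hr _ (hA u)
      · rw [eq_of_mem_options_of_notMem (hA u) hu]
        have hr' : r ∈ G.routinesFor h.deleted u :=
          routinesFor_antitone (by simp [History.deleted]) u hr
        by_cases hs : u ∈ Finset.univ.filter fun u => h.length + 1 ∈ G.schedule T h u
        · exact huniq _ _ _ u r hs hr' _ (hB u)
        · rw [eq_of_mem_options_of_notMem (hB u) hs]
          exact ih u r hr'
  induction hh with
  | start A hA => simp [History.length] at ht
  | step h B x A hh hlt hB hA ih =>
    by_cases htn : t ≤ h.length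
    · rw [recourse_step_of_le htn]
      exact ih (Finset.mem_Icc.2 ⟨(Finset.mem_Icc.1 ht).1, htn⟩)
    · obtain rfl : t = h.length + 1 := by
        simp only [History.length, Finset.mem_Icc] at ht; omega
      rw [recourse_step_length, Finset.card_eq_zero, Finset.sdiff_eq_empty_iff_subset]
      intro r hr
      simp only [edges, Finset.mem_filter, Finset.mem_univ, true_and] at hr ⊢
      have h1 := (IsRun.step h B x A hh hlt hB hA).mem_routinesFor_current (u := G.job r) hr
      exact hcur h hh _ r (routinesFor_antitone (by simp [History.deleted]) _ h1)

variable (G)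

/-! ### Resampling windows and the exponential supermartingale -/

/-- The first time after `s` in the schedule `S`, or `T + 1` if there is none (the value is
meaningful for `s ≤ T` only). -/
def nextTime (T : ℕ) (S : Finset ℕ) (s : ℕ) : ℕ :=
  sInf {e | s < e ∧ (e ∈ S ∨ e = T + 1)}

/-- The routines that contain a machine which the deletion sequence `σ` deletes at one of the times
`a, …, b - 1`. -/
def hitBetween (σ : ℕ → M) (a b : ℕ) : Finset R :=
  Finset.univ.filter fun r => ∃ t, a ≤ t ∧ t < b ∧ σ t ∈ G.machines r

/-- The routines which, under the deletion sequence `σ`, are deleted from the timestep following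
`h` on and before the next timestep for which job `u` is already scheduled. -/
def window (T : ℕ) (σ : ℕ → M) (h : History J M R) (u : J) : Finset R :=
  G.hitBetween σ (h.length + 1) (nextTime T (G.schedule T h u) (h.length + 1))

/-- The number of scheduled resamplings of job `u` that pick a routine of the current window. -/
def hits (T : ℕ) (σ : ℕ → M) : History J M R → J → ℕ
  | .start _, _ => 0
  | .step h B _ _, u => hits T σ h u +
      if h.length + 1 ∈ G.schedule T h u ∧ ∃ r ∈ G.window T σ h u, B u = some r then 1 else 0

/-- The fraction of the remaining routines of job `u` that lie in the current window: the
conditional probability that a resampling of `u` in the timestep following `h` is a hit. -/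
def hitProb (T : ℕ) (σ : ℕ → M) (h : History J M R) (u : J) : ℝ :=
  ((G.routinesFor h.deleted u ∩ G.window T σ h u).card : ℝ) / (G.routinesFor h.deleted u).card

/-- The sum of the conditional hit probabilities over the scheduled resamplings of job `u`. -/
def risk (T : ℕ) (σ : ℕ → M) : History J M R → J → ℝ
  | .start _, _ => 0
  | .step h _ _ _, u => risk T σ h u +
      if h.length + 1 ∈ G.schedule T h u then G.hitProb T σ h u else 0

/-- The exponential supermartingale of a deletion sequence `σ` that is fixed in advance. -/
def potential (T : ℕ) (σ : ℕ → M) (h : History J M R) : ℝ≥0∞ :=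
  ∏ u, ENNReal.ofReal (Real.exp (G.hits T σ h u - 2 * G.risk T σ h u))

/-- The factor by which job `u` changes the potential if it holds `o` after the scheduled
resampling. -/
def factor (T : ℕ) (σ : ℕ → M) (h : History J M R) (u : J) (o : Option R) : ℝ≥0∞ :=
  if h.length + 1 ∈ G.schedule T h u then
    ENNReal.ofReal (Real.exp ((if ∃ r ∈ G.window T σ h u, o = some r then 1 else 0)
      - 2 * G.hitProb T σ h u))
  else 1

theorem potential_start (T : ℕ) (σ : ℕ → M) (A : Assignment J R) :
    G.potential T σ (.start A) = 1 := by
  simp [potential, hits, risk]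

theorem potential_step (T : ℕ) (σ : ℕ → M) (h : History J M R) (B A : Assignment J R) (x : M) :
    G.potential T σ (.step h B x A) = G.potential T σ h * ∏ u, G.factor T σ h u (B u) := by
  rw [potential, potential, ← Finset.prod_mul_distrib]
  refine Finset.prod_congr rfl fun u _ => ?_
  rw [factor, hits, risk]
  by_cases hs : h.length + 1 ∈ G.schedule T h u
  · rw [if_pos hs, if_pos hs, ← ENNReal.ofReal_mul (Real.exp_nonneg _), ← Real.exp_add]
    congr 2
    simp only [hs, true_and]
    push_cast
    ring
  · simp [hs]

/-- Averaging a product over independent uniform choices factorizes. -/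
theorem tsum_resample_mul_prod_le (D : Finset M) (U : Finset J) (A : Assignment J R)
    (g : J → Option R → ℝ≥0∞)
    (hg : ∀ u, ∑ o ∈ G.options D U A u, g u o ≤ (G.options D U A u).card) :
    ∑' B, G.resample D U A B * ∏ u, g u (B u) ≤ 1 := by
  set S := Fintype.piFinset (G.options D U A) with hS
  have hne : S.Nonempty := Fintype.piFinset_nonempty.mpr (G.options_nonempty D U A)
  have hp : ∀ B, G.resample D U A B = if B ∈ S then (S.card : ℝ≥0∞)⁻¹ else 0 := fun B => by
    rw [resample, PMF.uniformOfFinset_apply]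
    congr
  rw [tsum_eq_sum (s := S) fun B hB => by rw [hp, if_neg hB, zero_mul]]
  calc ∑ B ∈ S, G.resample D U A B * ∏ u, g u (B u)
      = (S.card : ℝ≥0∞)⁻¹ * ∑ B ∈ S, ∏ u, g u (B u) := by
        rw [Finset.mul_sum]
        exact Finset.sum_congr rfl fun B hB => by rw [hp, if_pos hB]
    _ = (S.card : ℝ≥0∞)⁻¹ * ∏ u, ∑ o ∈ G.options D U A u, g u o := by
        rw [Finset.prod_univ_sum]
    _ ≤ (S.card : ℝ≥0∞)⁻¹ * ∏ u, ((G.options D U A u).card : ℝ≥0∞) := by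
        gcongr with u
        exact hg u
    _ = 1 := by
        rw [← Nat.cast_prod, ← Fintype.card_piFinset, ← hS]
        exact ENNReal.inv_mul_cancel (by simpa using hne.ne_empty) (by simp)

/-- The moment bound behind the supermartingale: a Bernoulli variable of mean `k / n` satisfies
`E exp (X - 2 k / n) ≤ 1`. -/
theorem card_mul_exp_le {n k : ℕ} (hk : k ≤ n) (hn : 0 < n) :
    (k : ℝ) * Real.exp (1 - 2 * (k / n)) + (n - k : ℕ) * Real.exp (0 - 2 * (k / n)) ≤ n := by
  have hn' : (0 : ℝ) < n := by exact_mod_cast hn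
  have h1 : Real.exp (1 - 2 * (k / n)) ≤ 3 * Real.exp (-(2 * (k / n : ℝ))) := by
    rw [sub_eq_add_neg, Real.exp_add]
    gcongr
    linarith [Real.exp_one_lt_d9]
  have h2 : (1 + 2 * (k / n : ℝ)) * Real.exp (-(2 * (k / n : ℝ))) ≤ 1 := by
    rw [Real.exp_neg, ← div_eq_mul_inv, div_le_one (Real.exp_pos _)]
    linarith [Real.add_one_le_exp (2 * (k / n : ℝ))]
  have h3 : (n : ℝ) * (k / n) = k := by field_simp
  rw [zero_sub, Nat.cast_sub hk]
  calc _ ≤ (k : ℝ) * (3 * Real.exp (-(2 * (k / n : ℝ)))) +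
        (n - k) * Real.exp (-(2 * (k / n : ℝ))) := by gcongr
    _ = n * ((1 + 2 * (k / n : ℝ)) * Real.exp (-(2 * (k / n : ℝ)))) := by
        linear_combination (-(2 * Real.exp (-(2 * (k / n : ℝ))))) * h3
    _ ≤ n * 1 := by gcongr
    _ = n := mul_one _

theorem sum_factor_le (T : ℕ) (σ : ℕ → M) (h : History J M R) (u : J) :
    ∑ o ∈ G.options h.deleted (Finset.univ.filter fun u => h.length + 1 ∈ G.schedule T h u)
      h.current u, G.factor T σ h u o ≤
    (G.options h.deleted (Finset.univ.filter fun u => h.length + 1 ∈ G.schedule T h u)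
      h.current u).card := by
  by_cases hs : h.length + 1 ∈ G.schedule T h u
  swap
  · simp [factor, hs]
  have hu : u ∈ Finset.univ.filter fun u => h.length + 1 ∈ G.schedule T h u := by simpa using hs
  simp only [factor, if_pos hs]
  rw [options, if_pos hu]
  split_ifs with hne
  · rw [Finset.sum_image fun a _ b _ hab => Option.some_injective _ hab,
      Finset.card_image_of_injective _ (Option.some_injective R),
      ← ENNReal.ofReal_sum_of_nonneg fun _ _ => Real.exp_nonneg _]
    refine ENNReal.ofReal_le_of_le_toReal ?_
    simp only [ENNReal.toReal_natCast, Option.some.injEq, exists_eq_right']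
    set N := G.routinesFor h.deleted u with hN
    set W := G.window T σ h u with hW
    have h1 : ∀ r ∈ N, Real.exp ((if r ∈ W then 1 else 0) - 2 * G.hitProb T σ h u) =
        if r ∈ W then Real.exp (1 - 2 * G.hitProb T σ h u)
        else Real.exp (0 - 2 * G.hitProb T σ h u) := fun r _ => by split_ifs <;> rfl
    rw [Finset.sum_congr rfl h1, Finset.sum_ite, Finset.sum_const, Finset.sum_const,
      nsmul_eq_mul, nsmul_eq_mul, Finset.filter_mem_eq_inter, Finset.filter_notMem_eq_sdiff,
      Finset.card_sdiff, Finset.inter_comm W N]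
    exact card_mul_exp_le (Finset.card_le_card Finset.inter_subset_left) hne.card_pos
  · rw [Finset.not_nonempty_iff_eq_empty] at hne
    simp [hitProb, hne]

theorem tsum_bind_mul {α β : Type*} (p : PMF α) (q : α → PMF β) (f : β → ℝ≥0∞) :
    ∑' b, p.bind q b * f b = ∑' a, p a * ∑' b, q a b * f b := by
  simp only [PMF.bind_apply, ← ENNReal.tsum_mul_right, ← ENNReal.tsum_mul_left]
  rw [ENNReal.tsum_comm]
  simp only [mul_assoc]

theorem tsum_map_mul {α β : Type*} (p : PMF α) (q : α → β) (f : β → ℝ≥0∞) :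
    ∑' b, p.map q b * f b = ∑' a, p a * f (q a) := by
  rw [PMF.map, tsum_bind_mul]
  refine tsum_congr fun a => ?_
  rw [tsum_eq_single (q a) fun b hb => by simp [hb]]
  simp

theorem tsum_nextStep_mul_potential_le (T : ℕ) (σ : ℕ → M) (adv : Adversary J M R)
    (h : History J M R) :
    ∑' h', G.nextStep T adv h h' * G.potential T σ h' ≤ G.potential T σ h := by
  rw [nextStep, tsum_bind_mul]
  simp only [tsum_bind_mul, tsum_map_mul, potential_step]
  simp only [ENNReal.tsum_mul_right, PMF.tsum_coe, one_mul]
  calc _ = G.potential T σ h * ∑' B, G.resample h.deleted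
        (Finset.univ.filter fun u => h.length + 1 ∈ G.schedule T h u) h.current B *
          ∏ u, G.factor T σ h u (B u) := by
        rw [← ENNReal.tsum_mul_left]
        exact tsum_congr fun B => mul_left_comm _ _ _
    _ ≤ G.potential T σ h * 1 := by
        gcongr
        exact G.tsum_resample_mul_prod_le _ _ _ _ (G.sum_factor_le T σ h)
    _ = _ := mul_one _

theorem tsum_run_mul_potential_le_one (T : ℕ) (σ : ℕ → M) (adv : Adversary J M R) (n : ℕ) :
    ∑' h, G.run T adv n h * G.potential T σ h ≤ 1 := by
  induction n with
  | zero =>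
    rw [run, tsum_map_mul]
    simp only [potential_start, mul_one]
    exact (PMF.tsum_coe _).le
  | succ n ih =>
    rw [run, tsum_bind_mul]
    refine le_trans (ENNReal.tsum_le_tsum fun h => ?_) ih
    gcongr
    exact G.tsum_nextStep_mul_potential_le T σ adv h

/-! ### Hits bound the number of touches -/

/-- The number of timesteps at which job `u` is touched. -/
def touchCount : History J M R → J → ℕ
  | .start _, _ => 0
  | .step h B x _, u => touchCount h u + if u ∈ G.touched B x then 1 else 0

/-- The last timestep at which job `u` is touched, `0` if there is none. -/
def lastTouch : History J M R → J → ℕ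
  | .start _, _ => 0
  | .step h B x _, u => if u ∈ G.touched B x then h.length + 1 else lastTouch h u

variable {G}

theorem nextTime_mem {T : ℕ} {S : Finset ℕ} {s : ℕ} (hs : s ≤ T) :
    s < nextTime T S s ∧ (nextTime T S s ∈ S ∨ nextTime T S s = T + 1) :=
  Nat.sInf_mem (s := {e | s < e ∧ (e ∈ S ∨ e = T + 1)}) ⟨T + 1, by omega, Or.inr rfl⟩

theorem nextTime_le {T : ℕ} {S : Finset ℕ} {s e : ℕ} (he : s < e) (heS : e ∈ S ∨ e = T + 1) :
    nextTime T S s ≤ e :=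
  Nat.sInf_le ⟨he, heS⟩

theorem lastTouch_le (h : History J M R) (u : J) : G.lastTouch h u ≤ h.length := by
  induction h with
  | start A => simp [lastTouch]
  | step h B x A ih =>
    rw [lastTouch, History.length]
    split_ifs <;> omega

theorem add_two_pow_mem_schedule {T : ℕ} {h : History J M R} {u : J} (hu : 1 ≤ G.lastTouch h u)
    {i : ℕ} (hi : G.lastTouch h u + 2 ^ i ≤ T) :
    G.lastTouch h u + 2 ^ i ∈ G.schedule T h u := by
  induction h with
  | start A => simp [lastTouch] at hu
  | step h B x A ih =>
    rw [mem_schedule_step]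
    rw [lastTouch] at hu hi ⊢
    by_cases hut : u ∈ G.touched B x
    · rw [if_pos hut] at hi ⊢
      exact Or.inr ⟨hut, hi, i, rfl⟩
    · rw [if_neg hut] at hu hi ⊢
      exact Or.inl (ih hu hi)

theorem one_le_lastTouch_of_mem_schedule {T : ℕ} {h : History J M R} {u : J} {s : ℕ}
    (hs : s ∈ G.schedule T h u) : 1 ≤ G.lastTouch h u := by
  induction h with
  | start A => simp [schedule] at hs
  | step h B x A ih =>
    rw [lastTouch]
    split_ifs with hu
    · omega
    · exact ih ((mem_schedule_step.1 hs).resolve_right fun h => hu h.1)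

theorem mem_schedule_step_of_notMem_touched {T : ℕ} {h : History J M R} {B A : Assignment J R}
    {x : M} {u : J} (hu : u ∉ G.touched B x) {s : ℕ} :
    s ∈ G.schedule T (.step h B x A) u ↔ s ∈ G.schedule T h u := by
  simp [mem_schedule_step, hu]

/-- Apart from the first one, each touch of a job is charged to the last scheduled resampling before
it, which was a hit. The window of that resampling is `[a, e)`. -/
theorem IsRun.touchCount_invariant {T : ℕ} {h : History J M R} (hh : G.IsRun T h) {σ : ℕ → M}
    (hσ : h.Follows σ) (u : J) :
    G.touchCount h u ≤ G.hits T σ h u + (if G.lastTouch h u = 0 then 0 else 1) ∧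
    (1 ≤ G.lastTouch h u → G.lastTouch h u < h.length → ∃ a e : ℕ, a ≤ h.length ∧ h.length < e ∧
      (e ∈ G.schedule T h u ∨ e = T + 1) ∧ (∀ s ∈ G.schedule T h u, a < s → e ≤ s) ∧
      ((∃ r ∈ G.hitBetween σ a e, h.current u = some r) →
        G.touchCount h u ≤ G.hits T σ h u)) := by
  induction hh with
  | start A hA => simp [touchCount, lastTouch]
  | step h B x A hh hlt hB hA ih =>
    obtain ⟨ih1, ih2⟩ := ih hσ.1
    have hlast := G.lastTouch_le h u
    -- The state after the scheduled resampling, just before the deletion.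
    have key : 1 ≤ G.lastTouch h u → ∃ a e : ℕ, a ≤ h.length + 1 ∧ h.length + 1 < e ∧
        (e ∈ G.schedule T h u ∨ e = T + 1) ∧ (∀ s ∈ G.schedule T h u, a < s → e ≤ s) ∧
        ((∃ r ∈ G.hitBetween σ a e, B u = some r) →
          G.touchCount h u ≤ G.hits T σ (.step h B x A) u) := by
      intro h1
      by_cases hs : h.length + 1 ∈ G.schedule T h u
      · obtain ⟨h2, h3⟩ := nextTime_mem (S := G.schedule T h u) (s := h.length + 1) hlt
        refine ⟨_, _, le_rfl, h2, h3, fun s hs' hlts => nextTime_le hlts (Or.inl hs'), ?_⟩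
        rintro ⟨r, hr, hBr⟩
        rw [hits, if_pos ⟨hs, r, hr, hBr⟩]
        split_ifs at ih1 <;> omega
      · have h2 : G.lastTouch h u < h.length := by
          by_contra hcon
          have h3 : G.lastTouch h u = h.length := by omega
          refine hs ?_
          have := G.add_two_pow_mem_schedule h1 (i := 0) (T := T) (by rw [h3]; simpa using hlt)
          rwa [h3] at this
        obtain ⟨a, e, ha, he, heS, hmin, himp⟩ := ih2 h1 h2
        have hne : e ≠ h.length + 1 := by
          rintro rfl
          rcases heS with heS | heS
          · exact hs heS
          · omega
        refine ⟨a, e, by omega, by omega, heS, hmin, ?_⟩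
        rintro ⟨r, hr, hBr⟩
        have hBu := eq_of_mem_options_of_notMem (hB u) (by simpa using hs)
        have := himp ⟨r, hr, by rw [← hBu, hBr]⟩
        rw [hits]
        omega
    have hmono : G.hits T σ h u ≤ G.hits T σ (.step h B x A) u := by rw [hits]; omega
    by_cases hu : u ∈ G.touched B x
    · simp only [touchCount, lastTouch, if_pos hu, History.length]
      refine ⟨?_, fun _ h2 => absurd h2 (lt_irrefl _)⟩
      rw [if_neg (by omega)]
      by_cases h1 : 1 ≤ G.lastTouch h u
      · obtain ⟨a, e, ha, he, -, -, himp⟩ := key h1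
        obtain ⟨r, hr, hx⟩ := mem_touched.1 hu
        have := himp ⟨r, by
          simp only [hitBetween, Finset.mem_filter, Finset.mem_univ, true_and]
          exact ⟨h.length + 1, ha, he, by rw [hσ.2]; exact hx⟩, hr⟩
        omega
      · rw [if_pos (by omega)] at ih1
        omega
    · simp only [touchCount, lastTouch, if_neg hu, History.length, add_zero, History.current,
        mem_schedule_step_of_notMem_touched hu, eq_of_mem_options_of_notMem (hA u) hu]
      exact ⟨by omega, fun h1 _ => key h1⟩

theorem IsRun.touchCount_le {T : ℕ} {h : History J M R} (hh : G.IsRun T h) {σ : ℕ → M}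
    (hσ : h.Follows σ) (u : J) : G.touchCount h u ≤ G.hits T σ h u + 1 := by
  have := (hh.touchCount_invariant hσ u).1
  split_ifs at this <;> omega

/-! ### The total risk of a job -/

/-- An upper bound for the harmonic numbers, with value `0` at `0`. -/
def oneAddLog (d : ℕ) : ℝ := if d = 0 then 0 else 1 + Real.log d

theorem oneAddLog_nonneg (d : ℕ) : 0 ≤ oneAddLog d := by
  rw [oneAddLog]
  split_ifs
  · exact le_rfl
  · linarith [Real.log_natCast_nonneg d]

/-- Passing from `a` to `b` items uses up at least the fraction lost. -/
theorem sub_div_le_oneAddLog_sub {a b : ℕ} (hba : b ≤ a) :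
    ((a : ℝ) - b) / a ≤ oneAddLog a - oneAddLog b := by
  rcases Nat.eq_zero_or_pos b with rfl | hb
  · rcases Nat.eq_zero_or_pos a with rfl | ha
    · simp
    · have : (a : ℝ) ≠ 0 := by positivity
      simp only [oneAddLog, if_neg ha.ne', if_true, Nat.cast_zero, sub_zero, div_self this]
      linarith [Real.log_natCast_nonneg a]
  · have ha : 0 < a := by omega
    have ha' : (0 : ℝ) < a := by exact_mod_cast ha
    have hb' : (0 : ℝ) < b := by exact_mod_cast hb
    simp only [oneAddLog, if_neg ha.ne', if_neg hb.ne']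
    have h1 := Real.one_sub_inv_le_log_of_pos (x := (a : ℝ) / b) (by positivity)
    rw [Real.log_div ha'.ne' hb'.ne', inv_div] at h1
    rw [sub_div, div_self ha'.ne']
    linarith

theorem oneAddLog_mono {a b : ℕ} (hba : b ≤ a) : oneAddLog b ≤ oneAddLog a := by
  have h1 := sub_div_le_oneAddLog_sub hba
  have h2 : (b : ℝ) ≤ a := by exact_mod_cast hba
  have h3 : 0 ≤ ((a : ℝ) - b) / a := div_nonneg (by linarith) (by positivity)
  linarith

variable (G) in
/-- The number of routines of job `u` that survive the deletions of `σ` before time `s`. -/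
def degreeAt (σ : ℕ → M) (u : J) (s : ℕ) : ℕ :=
  (G.routinesFor ((Finset.Ico 1 s).image σ) u).card

theorem degreeAt_antitone (σ : ℕ → M) (u : J) {s e : ℕ} (hse : s ≤ e) :
    G.degreeAt σ u e ≤ G.degreeAt σ u s :=
  Finset.card_le_card (routinesFor_antitone
    (Finset.image_subset_image (Finset.Ico_subset_Ico_right hse)) u)

theorem hitProb_le {T : ℕ} {σ : ℕ → M} {h : History J M R} (hσ : h.Follows σ) (u : J) {e : ℕ}
    (he : nextTime T (G.schedule T h u) (h.length + 1) = e) (hse : h.length + 1 ≤ e) :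
    G.hitProb T σ h u ≤
      oneAddLog (G.degreeAt σ u (h.length + 1)) - oneAddLog (G.degreeAt σ u e) := by
  refine le_trans (le_of_eq ?_) (sub_div_le_oneAddLog_sub (degreeAt_antitone σ u hse))
  rw [hitProb, hσ.deleted_eq, window, he, degreeAt, degreeAt]
  congr 1
  set N := G.routinesFor ((Finset.Ico 1 (h.length + 1)).image σ) u with hN
  have h1 : N \ G.hitBetween σ (h.length + 1) e =
      G.routinesFor ((Finset.Ico 1 e).image σ) u := by
    ext r
    simp only [hN, hitBetween, Finset.mem_sdiff, Finset.mem_filter, Finset.mem_univ, true_and,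
      mem_routinesFor, Finset.disjoint_right, Finset.mem_image, Finset.mem_Ico,
      forall_exists_index, and_imp]
    constructor
    · rintro ⟨⟨hj, h2⟩, h3⟩
      refine ⟨hj, ?_⟩
      rintro _ t ht1 ht2 rfl hx
      by_cases ht : t < h.length + 1
      · exact h2 t ht1 ht rfl hx
      · exact h3 ⟨t, by omega, ht2, hx⟩
    · rintro ⟨hj, h2⟩
      refine ⟨⟨hj, ?_⟩, ?_⟩
      · rintro _ t ht1 ht2 rfl hx
        exact h2 t ht1 (by omega) rfl hx
      · rintro ⟨t, ht1, ht2, hx⟩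
        exact h2 t (by omega) ht2 rfl hx
  rw [← h1, eq_sub_iff_add_eq]
  exact_mod_cast Finset.card_inter_add_card_sdiff N _

/-- The next scheduled time is at most as far ahead as the last touch lies behind. -/
theorem nextTime_add_lastTouch_le {T : ℕ} {h : History J M R} {u : J} {s : ℕ}
    (h1 : 1 ≤ G.lastTouch h u) (hs : G.lastTouch h u < s) (hsT : s ≤ T) :
    nextTime T (G.schedule T h u) s + G.lastTouch h u ≤ 2 * s := by
  set t := G.lastTouch h u with ht
  have h2 : 2 ^ Nat.log 2 (s - t) ≤ s - t := Nat.pow_log_le_self 2 (by omega)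
  have h3 : s - t < 2 ^ (Nat.log 2 (s - t) + 1) := Nat.lt_pow_succ_log_self (by norm_num) _
  have h4 : nextTime T (G.schedule T h u) s ≤ t + 2 ^ (Nat.log 2 (s - t) + 1) := by
    by_cases hT : t + 2 ^ (Nat.log 2 (s - t) + 1) ≤ T
    · exact nextTime_le (by omega) (Or.inl (G.add_two_pow_mem_schedule h1 hT))
    · exact (nextTime_le (e := T + 1) (by omega) (Or.inr rfl)).trans (by omega)
  rw [pow_succ] at h4
  omega

/-- Windows of one job whose lengths have the same binary logarithm are disjoint: a window opened
inside another one comes after a touch inside that one, hence has at most half its length. So each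
of the `log T` length classes contributes at most a harmonic sum. In the invariant, `[a j, e j)` is
the last window of class `j`. -/
theorem IsRun.risk_invariant {T : ℕ} {h : History J M R} (hh : G.IsRun T h) {σ : ℕ → M}
    (hσ : h.Follows σ) (u : J) : ∃ a e : ℕ → ℕ,
    G.risk T σ h u ≤ ∑ j ∈ Finset.range (Nat.log 2 T + 1),
      (oneAddLog G.maxDegree - oneAddLog (G.degreeAt σ u (e j))) ∧
    ∀ j, h.length < e j → a j ≤ h.length ∧ Nat.log 2 (e j - a j) = j ∧
      (e j ∈ G.schedule T h u ∨ e j = T + 1) ∧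
      (a j ≤ G.lastTouch h u ∨ ∀ s ∈ G.schedule T h u, a j < s → e j ≤ s) := by
  induction hh with
  | start A hA =>
    refine ⟨0, 0, ?_, fun j hj => by simp at hj⟩
    rw [risk]
    exact Finset.sum_nonneg fun j _ =>
      sub_nonneg.2 (oneAddLog_mono (card_routinesFor_le_maxDegree _ u))
  | step h B x A hh hlt hB hA ih =>
    obtain ⟨a, e, hrisk, hwin⟩ := ih hσ.1
    have hlast := G.lastTouch_le h u
    -- Windows that stay open keep their properties.
    have hkeep : ∀ a e j : ℕ, a ≤ h.length + 1 → Nat.log 2 (e - a) = j →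
        (e ∈ G.schedule T h u ∨ e = T + 1) →
        (a ≤ G.lastTouch h u ∨ ∀ s ∈ G.schedule T h u, a < s → e ≤ s) →
        a ≤ h.length + 1 ∧ Nat.log 2 (e - a) = j ∧
        (e ∈ G.schedule T (.step h B x A) u ∨ e = T + 1) ∧
        (a ≤ G.lastTouch (.step h B x A) u ∨
          ∀ s ∈ G.schedule T (.step h B x A) u, a < s → e ≤ s) := by
      intro a e j h1 h2 h3 h4
      refine ⟨h1, h2, h3.imp_left fun h5 => mem_schedule_step.2 (Or.inl h5), ?_⟩
      by_cases hu : u ∈ G.touched B x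
      · exact Or.inl (by rw [lastTouch, if_pos hu]; exact h1)
      · simpa only [lastTouch, if_neg hu, mem_schedule_step_of_notMem_touched hu] using h4
    simp only [History.length]
    by_cases hs : h.length + 1 ∈ G.schedule T h u
    swap
    · refine ⟨a, e, by simpa [risk, hs] using hrisk, fun j hj => ?_⟩
      obtain ⟨h1, h2, h3, h4⟩ := hwin j (by omega)
      exact hkeep _ _ _ (by omega) h2 h3 h4
    obtain ⟨hsn, hnS⟩ := nextTime_mem (S := G.schedule T h u) (s := h.length + 1) hlt
    obtain ⟨n, hn⟩ : ∃ n, nextTime T (G.schedule T h u) (h.length + 1) = n := ⟨_, rfl⟩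
    have hnT : n ≤ T + 1 := hn ▸ nextTime_le (by omega) (Or.inr rfl)
    have h1 := G.one_le_lastTouch_of_mem_schedule hs
    have hgap := G.nextTime_add_lastTouch_le h1 (s := h.length + 1) (by omega) hlt
    rw [hn] at hsn hnS hgap
    obtain ⟨k, hk⟩ : ∃ k, Nat.log 2 (n - (h.length + 1)) = k := ⟨_, rfl⟩
    have hkT : k ∈ Finset.range (Nat.log 2 T + 1) := by
      rw [Finset.mem_range, Nat.lt_succ_iff, ← hk]
      exact Nat.log_mono_right (by omega)
    -- A window of the same length class that is still open would contain the new window, together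
    -- with the touch before it, and so be twice as long.
    have hek : e k ≤ h.length + 1 := by
      by_contra hcon
      obtain ⟨h2, h3, h4, h5⟩ := hwin k (by omega)
      have h6 : a k ≤ G.lastTouch h u := by
        refine h5.resolve_right fun h5 => hcon (h5 _ hs (by omega))
      have h7 : n ≤ e k := hn ▸ nextTime_le (by omega) h4
      have h8 : Nat.log 2 ((n - (h.length + 1)) * 2) ≤ Nat.log 2 (e k - a k) :=
        Nat.log_mono_right (by omega)
      rw [Nat.log_mul_base (by norm_num) (by omega)] at h8
      omega
    refine ⟨Function.update a k (h.length + 1), Function.update e k n, ?_, fun j hj => ?_⟩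
    · rw [risk, if_pos hs]
      have h2 := hitProb_le (T := T) hσ.1 u hn (by omega)
      have h3 : oneAddLog (G.degreeAt σ u (h.length + 1)) ≤ oneAddLog (G.degreeAt σ u (e k)) :=
        oneAddLog_mono (degreeAt_antitone σ u hek)
      rw [← Finset.add_sum_erase _ _ hkT] at hrisk ⊢
      have h4 : ∑ j ∈ (Finset.range (Nat.log 2 T + 1)).erase k, (oneAddLog G.maxDegree -
            oneAddLog (G.degreeAt σ u (Function.update e k n j))) =
          ∑ j ∈ (Finset.range (Nat.log 2 T + 1)).erase k, (oneAddLog G.maxDegree -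
            oneAddLog (G.degreeAt σ u (e j))) :=
        Finset.sum_congr rfl fun j hj => by
          rw [Function.update_of_ne (Finset.ne_of_mem_erase hj)]
      rw [h4, Function.update_self]
      linarith
    · by_cases hjk : j = k
      · subst hjk
        rw [Function.update_self, Function.update_self]
        exact hkeep _ _ _ le_rfl hk hnS
          (Or.inr fun s hs' hlts => hn ▸ nextTime_le hlts (Or.inl hs'))
      · rw [Function.update_of_ne hjk] at hj
        rw [Function.update_of_ne hjk, Function.update_of_ne hjk]
        obtain ⟨h2, h3, h4, h5⟩ := hwin j (by omega)
        exact hkeep _ _ _ (by omega) h3 h4 h5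

theorem IsRun.risk_le {T : ℕ} {h : History J M R} (hh : G.IsRun T h) {σ : ℕ → M}
    (hσ : h.Follows σ) (u : J) :
    G.risk T σ h u ≤ (Nat.log 2 T + 1) * oneAddLog G.maxDegree := by
  obtain ⟨a, e, hrisk, -⟩ := hh.risk_invariant hσ u
  refine hrisk.trans ?_
  calc _ ≤ ∑ j ∈ Finset.range (Nat.log 2 T + 1), oneAddLog G.maxDegree :=
        Finset.sum_le_sum fun j _ => sub_le_self _ (oneAddLog_nonneg _)
    _ = _ := by simp

/-! ### From touches to recourse -/

theorem card_schedule_le (T : ℕ) (h : History J M R) (u : J) :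
    (G.schedule T h u).card ≤ G.touchCount h u * (Nat.log 2 T + 1) := by
  induction h with
  | start A => simp [schedule]
  | step h B x A ih =>
    rw [schedule, touchCount, add_mul]
    refine (Finset.card_union_le _ _).trans (add_le_add ih ?_)
    split_ifs
    · rw [one_mul]
      calc _ ≤ ((Finset.range (Nat.log 2 T + 1)).image fun i => h.length + 1 + 2 ^ i).card := by
            refine Finset.card_le_card fun s hs => ?_
            simp only [Finset.mem_filter, Finset.mem_Icc] at hs
            obtain ⟨hs, i, rfl⟩ := hs
            refine Finset.mem_image.2 ⟨i, ?_, rfl⟩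
            rw [Finset.mem_range, Nat.lt_succ_iff]
            exact Nat.le_log_of_pow_le (by norm_num) (by omega)
        _ ≤ _ := Finset.card_image_le.trans (by simp)
    · simp

/-- A job is resampled once for each of its past scheduled times and once for each touch. -/
theorem IsRun.totalRecourse_le_sum {T : ℕ} {h : History J M R} (hh : G.IsRun T h) :
    G.totalRecourse h.length h ≤
      ∑ u, (((G.schedule T h u).filter (· ≤ h.length)).card + G.touchCount h u) := by
  induction hh with
  | start A hA => simp [totalRecourse, History.length]
  | step h B x A hh hlt hB hA ih =>
    rw [totalRecourse, History.length, Finset.sum_Icc_succ_top (by omega), recourse_step_length]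
    have h1 : ∑ t ∈ Finset.Icc 1 h.length, G.recourse (.step h B x A) t =
        G.totalRecourse h.length h :=
      Finset.sum_congr rfl fun t ht => recourse_step_of_le (Finset.mem_Icc.1 ht).2
    rw [h1]
    have h2 := card_edges_sdiff_le hB hA
    rw [Finset.card_filter] at h2
    have h3 : (G.touched B x).card = ∑ u, if u ∈ G.touched B x then 1 else 0 := by simp
    rw [h3] at h2
    refine (add_le_add ih h2).trans ?_
    rw [← Finset.sum_add_distrib, ← Finset.sum_add_distrib]
    refine Finset.sum_le_sum fun u _ => ?_
    rw [touchCount]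
    have h4 : ((G.schedule T h u).filter (· ≤ h.length)).card +
        (if h.length + 1 ∈ G.schedule T h u then 1 else 0) ≤
        ((G.schedule T (.step h B x A) u).filter (· ≤ h.length + 1)).card := by
      split_ifs with hs
      · rw [← Finset.card_insert_of_notMem (a := h.length + 1) (by simp)]
        refine Finset.card_le_card fun s hs' => ?_
        rw [Finset.mem_insert, Finset.mem_filter] at hs'
        rw [Finset.mem_filter, mem_schedule_step]
        rcases hs' with rfl | hs'
        · exact ⟨Or.inl hs, le_rfl⟩
        · exact ⟨Or.inl hs'.1, by omega⟩
      · refine Finset.card_le_card fun s hs' => ?_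
        rw [Finset.mem_filter] at hs'
        rw [Finset.mem_filter, mem_schedule_step]
        exact ⟨Or.inl hs'.1, by omega⟩
    omega

theorem IsRun.totalRecourse_le {T : ℕ} {h : History J M R} (hh : G.IsRun T h) :
    G.totalRecourse h.length h ≤ (Nat.log 2 T + 2) * ∑ u, G.touchCount h u := by
  refine hh.totalRecourse_le_sum.trans ?_
  rw [Finset.mul_sum]
  refine Finset.sum_le_sum fun u _ => ?_
  have h1 := (Finset.card_filter_le (G.schedule T h u) (· ≤ h.length)).trans
    (card_schedule_le T h u)
  linarith

/-! ### The probabilistic bound -/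

theorem natLog_two_mul_log_two_le {T : ℕ} (hT : 1 ≤ T) :
    (Nat.log 2 T : ℝ) * Real.log 2 ≤ Real.log T := by
  have h1 : ((2 ^ Nat.log 2 T : ℕ) : ℝ) ≤ T := by
    exact_mod_cast Nat.pow_log_le_self 2 (by omega)
  have h2 := Real.log_le_log (by positivity) h1
  rwa [Nat.cast_pow, Real.log_pow, Nat.cast_ofNat] at h2

theorem potential_eq (T : ℕ) (σ : ℕ → M) (h : History J M R) :
    G.potential T σ h =
      ENNReal.ofReal (Real.exp (∑ u, ((G.hits T σ h u : ℝ) - 2 * G.risk T σ h u))) := by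
  rw [potential, Real.exp_sum, ENNReal.ofReal_prod_of_nonneg fun _ _ => Real.exp_nonneg _]

/-- If the potential of the true deletion sequence is small, then the total recourse is small. -/
theorem IsRun.totalRecourse_le_of_sum_le [Fintype M] {T c : ℕ} {h : History J M R}
    (hh : G.IsRun T h) (hlen : h.length = T) {σ : ℕ → M} (hσ : h.Follows σ) (hT : 1 ≤ T)
    (hTM : T ≤ Fintype.card M) (hM : 2 ≤ Fintype.card M) (hdeg : 2 ≤ G.maxDegree)
    (hsum : ∑ u, ((G.hits T σ h u : ℝ) - 2 * G.risk T σ h u) ≤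
      (T + c) * Real.log (Fintype.card M)) :
    (G.totalRecourse T h : ℝ) ≤ (110 + 5 * c) *
      ((Fintype.card J : ℝ) * Real.log (G.maxDegree : ℝ) * Real.log (Fintype.card M : ℝ) ^ 2
        + (T : ℝ) * Real.log (Fintype.card M : ℝ) ^ 2) := by
  have hrec := hh.totalRecourse_le
  rw [hlen] at hrec
  have hrec' : (G.totalRecourse T h : ℝ) ≤ (Nat.log 2 T + 2) * ∑ u, (G.touchCount h u : ℝ) := by
    exact_mod_cast hrec
  have htouch : ∑ u, (G.touchCount h u : ℝ) ≤ ∑ u, ((G.hits T σ h u : ℝ) + 1) :=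
    Finset.sum_le_sum fun u _ => by exact_mod_cast hh.touchCount_le hσ u
  have hrisk : ∑ u, G.risk T σ h u ≤
      ∑ _u : J, ((Nat.log 2 T + 1 : ℝ) * oneAddLog G.maxDegree) :=
    Finset.sum_le_sum fun u _ => hh.risk_le hσ u
  rw [Finset.sum_sub_distrib, ← Finset.mul_sum] at hsum
  rw [Finset.sum_add_distrib, Finset.sum_const, Finset.card_univ, nsmul_eq_mul, mul_one] at htouch
  rw [Finset.sum_const, Finset.card_univ, nsmul_eq_mul, oneAddLog, if_neg (by omega)] at hrisk
  -- As `T ≤ |M|`, `2 ≤ |M|` and `2 ≤ Δ`, the additive constants are absorbed by the logarithms.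
  have hln := natLog_two_mul_log_two_le hT
  have hl2 := Real.log_two_gt_d9
  have hL2 : Real.log 2 ≤ Real.log (Fintype.card M) :=
    Real.log_le_log (by norm_num) (by exact_mod_cast hM)
  have hLT : Real.log T ≤ Real.log (Fintype.card M) :=
    Real.log_le_log (by exact_mod_cast hT) (by exact_mod_cast hTM)
  have hD2 : Real.log 2 ≤ Real.log G.maxDegree :=
    Real.log_le_log (by norm_num) (by exact_mod_cast hdeg)
  have hT' : (1 : ℝ) ≤ T := by exact_mod_cast hT
  have hc : (0 : ℝ) ≤ c := Nat.cast_nonneg c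
  have hj : (0 : ℝ) ≤ Fintype.card J := Nat.cast_nonneg _
  have hk0 : (0 : ℝ) ≤ Nat.log 2 T := Nat.cast_nonneg _
  set L := Real.log (Fintype.card M)
  set D := Real.log G.maxDegree
  set k : ℝ := (Nat.log 2 T : ℝ)
  set j : ℝ := (Fintype.card J : ℝ)
  have hk1 : k * 0.69 ≤ L := by nlinarith
  have hk2 : k + 1 ≤ 3 * L := by linarith
  have hk3 : k + 2 ≤ 5 * L := by linarith
  have hD3 : 1 + D ≤ 3 * D := by linarith
  have hkD : (k + 1) * (1 + D) ≤ 3 * L * (3 * D) := by gcongr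
  have hLD : 1 ≤ 3 * (L * D) := by nlinarith
  have h1 : j * ((k + 1) * (1 + D)) ≤ j * (3 * L * (3 * D)) := by gcongr
  have h2 : j * 1 ≤ j * (3 * (L * D)) := by gcongr
  have h3 : (T + c : ℝ) * L ≤ (1 + c) * T * L := by
    refine mul_le_mul_of_nonneg_right ?_ (by linarith)
    nlinarith
  have h4 : ∑ u, (G.touchCount h u : ℝ) ≤ 21 * (j * D * L) + (1 + c) * T * L := by
    linarith
  have hL0 : 0 ≤ L := by linarith
  have hD0 : 0 ≤ D := by linarith
  calc (G.totalRecourse T h : ℝ) ≤ (k + 2) * ∑ u, (G.touchCount h u : ℝ) := hrec'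
    _ ≤ 5 * L * (21 * (j * D * L) + (1 + c) * T * L) := by gcongr
    _ = 105 * (j * D * L ^ 2) + (5 + 5 * c) * (T * L ^ 2) := by ring
    _ ≤ (110 + 5 * c) * (j * D * L ^ 2) + (110 + 5 * c) * (T * L ^ 2) := by
        gcongr <;> linarith
    _ = _ := by ring

/-- Markov's inequality for a finite sum of functions of mean at most one. -/
theorem one_sub_le_toOuterMeasure {α ι : Type*} [Fintype ι] (p : PMF α) (f : ι → α → ℝ≥0∞)
    (hf : ∀ i, ∑' a, p a * f i a ≤ 1) (S : Set α) {m : ℕ} (hm : 1 ≤ m) {b c : ℕ}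
    (hι : Fintype.card ι = m ^ b)
    (hS : ∀ a ∈ p.support, a ∉ S → (m : ℝ≥0∞) ^ (b + c) ≤ ∑ i, f i a) :
    ENNReal.ofReal (1 - 1 / (m : ℝ) ^ c) ≤ p.toOuterMeasure S := by
  have hm0 : (m : ℝ≥0∞) ≠ 0 := by simpa using (by omega : m ≠ 0)
  have hsum : p.toOuterMeasure S + p.toOuterMeasure Sᶜ = 1 := by
    rw [PMF.toOuterMeasure_apply, PMF.toOuterMeasure_apply, ← ENNReal.tsum_add, ← p.tsum_coe]
    refine tsum_congr fun a => ?_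
    by_cases ha : a ∈ S <;> simp [ha]
  have hbad : (m : ℝ≥0∞) ^ (b + c) * p.toOuterMeasure Sᶜ ≤ (m : ℝ≥0∞) ^ b := by
    rw [PMF.toOuterMeasure_apply, ← ENNReal.tsum_mul_left]
    calc _ ≤ ∑' a, p a * ∑ i, f i a := by
          refine ENNReal.tsum_le_tsum fun a => ?_
          by_cases ha : a ∈ S
          · simp [ha]
          · by_cases hp : a ∈ p.support
            · rw [Set.indicator_of_mem (by simpa using ha), mul_comm]
              gcongr
              exact hS a hp ha
            · rw [← PMF.apply_eq_zero_iff] at hp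
              simp [Set.indicator, hp]
      _ = ∑ i, ∑' a, p a * f i a := by
          simp only [Finset.mul_sum]
          exact Summable.tsum_finsetSum fun _ _ => ENNReal.summable
      _ ≤ ∑ _i : ι, 1 := Finset.sum_le_sum fun i _ => hf i
      _ = _ := by simp [hι]
  have hbad' : p.toOuterMeasure Sᶜ ≤ ((m : ℝ≥0∞) ^ c)⁻¹ := by
    rw [pow_add, mul_assoc] at hbad
    have h1 : (m : ℝ≥0∞) ^ c * p.toOuterMeasure Sᶜ ≤ 1 := by
      refine (ENNReal.mul_le_mul_iff_right (pow_ne_zero b hm0)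
        (ENNReal.pow_ne_top (ENNReal.natCast_ne_top m))).1 (hbad.trans (mul_one _).ge)
    rw [ENNReal.le_inv_iff_mul_le, mul_comm]
    exact h1
  have hinv : ENNReal.ofReal (1 / (m : ℝ) ^ c) = ((m : ℝ≥0∞) ^ c)⁻¹ := by
    have : (0 : ℝ) < (m : ℝ) ^ c := by positivity
    rw [one_div, ENNReal.ofReal_inv_of_pos this, ENNReal.ofReal_pow (by positivity),
      ENNReal.ofReal_natCast]
  rw [ENNReal.ofReal_sub _ (by positivity), ENNReal.ofReal_one, hinv, tsub_le_iff_right, ← hsum]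
  gcongr

/-- A sequence that takes the value `σ i` at time `i + 1`. -/
def extendSeq [Nonempty M] {T : ℕ} (σ : Fin T → M) (t : ℕ) : M :=
  if ht : t - 1 < T then σ ⟨t - 1, ht⟩ else Classical.arbitrary M

theorem exists_follows_extendSeq [Nonempty M] {T : ℕ} {h : History J M R} (hlen : h.length = T) :
    ∃ σ : Fin T → M, h.Follows (extendSeq σ) := by
  obtain ⟨τ, hτ⟩ := h.exists_follows
  refine ⟨fun i => τ (i + 1), History.follows_congr hτ fun t ht => ?_⟩
  rw [hlen, Finset.mem_Icc] at ht
  rw [extendSeq, dif_pos (by omega)]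
  exact congrArg τ (by simp only; omega)

/-- The bound on the total recourse with an explicit constant. The potentials of all deletion
sequences are summed, since which of them the adversary follows depends on the random choices. -/
theorem totalRecourse_bound [Fintype M] (G : Graph J M R) (c : ℕ) {T : ℕ}
    (hTM : T ≤ Fintype.card M) (adv : Adversary J M R) :
    ENNReal.ofReal (1 - 1 / (Fintype.card M : ℝ) ^ c) ≤
      (G.run T adv T).toOuterMeasure
        {h | (G.totalRecourse T h : ℝ) ≤ (110 + 5 * c) *
          ((Fintype.card J : ℝ) * Real.log (G.maxDegree : ℝ)
              * Real.log (Fintype.card M : ℝ) ^ 2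
            + (T : ℝ) * Real.log (Fintype.card M : ℝ) ^ 2)} := by
  rcases Nat.eq_zero_or_pos T with rfl | hT
  · rw [(PMF.toOuterMeasure_apply_eq_one_iff _ _).2 fun h _ => ?_]
    · exact ENNReal.ofReal_le_one.2 (sub_le_self _ (by positivity))
    · have := Real.log_natCast_nonneg G.maxDegree
      simp only [totalRecourse, Finset.Icc_eq_empty_of_lt zero_lt_one, Finset.sum_empty,
        Nat.cast_zero, Set.mem_ofPred_eq]
      positivity
  rcases Nat.lt_or_ge (Fintype.card M) 2 with hM | hM
  · obtain h1 : Fintype.card M = 1 := by omega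
    simp [h1]
  have : Nonempty M := Fintype.card_pos_iff.1 (by omega)
  refine one_sub_le_toOuterMeasure (ι := Fin T → M) _
    (fun σ h => G.potential T (extendSeq σ) h)
    (fun σ => G.tsum_run_mul_potential_le_one T _ adv T) _ (by omega) (b := T) (by simp) ?_
  intro h hsupp hbad
  obtain ⟨hh, hlen⟩ := G.isRun_of_mem_support le_rfl hsupp
  obtain ⟨σ, hσ⟩ := exists_follows_extendSeq hlen
  refine le_trans ?_ (Finset.single_le_sum (f := fun σ : Fin T → M =>
    G.potential T (extendSeq σ) h) (fun _ _ => zero_le) (Finset.mem_univ σ))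
  rw [Set.mem_ofPred_eq] at hbad
  by_contra hcon
  refine hbad ?_
  rcases Nat.lt_or_ge G.maxDegree 2 with hdeg | hdeg
  · have h0 : G.totalRecourse T h = 0 := by
      rw [totalRecourse]
      exact Finset.sum_eq_zero fun t ht => hh.recourse_eq_zero (by omega) (by rwa [hlen])
    rw [h0, Nat.cast_zero]
    have := Real.log_natCast_nonneg G.maxDegree
    positivity
  · refine hh.totalRecourse_le_of_sum_le hlen hσ hT hTM hM hdeg ?_
    have hm : (0 : ℝ) < Fintype.card M := by positivity
    rw [potential_eq, not_le, ← ENNReal.ofReal_natCast (Fintype.card M),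
      ← ENNReal.ofReal_pow hm.le, ENNReal.ofReal_lt_ofReal_iff (by positivity),
      ← Real.lt_log_iff_exp_lt (by positivity), Real.log_pow] at hcon
    exact_mod_cast hcon.le

end Graph

end

end JobMachine

theorem mainTheorem4 :
    (∀ c : ℕ, ∃ C : ℝ, 0 < C ∧
      ∀ (J M R : Type*) [Fintype J] [Fintype M] [Fintype R] (G : JobMachine.Graph J M R)
        (T : ℕ) (_ : T ≤ Fintype.card M) (adv : JobMachine.Adversary J M R),
        ENNReal.ofReal (1 - 1 / (Fintype.card M : ℝ) ^ c) ≤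
          (G.run T adv T).toOuterMeasure
            {h | (G.totalRecourse T h : ℝ) ≤
              C * ((Fintype.card J : ℝ) * Real.log (G.maxDegree : ℝ)
                    * Real.log (Fintype.card M : ℝ) ^ 2
                  + (T : ℝ) * Real.log (Fintype.card M : ℝ) ^ 2)}) ∧
    (∃ C : ℝ, 0 < C ∧
      ∀ (J M R : Type*) [Fintype J] [Fintype M] [Fintype R] (G : JobMachine.Graph J M R)
        (T : ℕ) (_ : 2 ≤ T) (_ : T ≤ Fintype.card M) (adv : JobMachine.Adversary J M R),
        ∀ h ∈ (G.run T adv T).support, ∀ lam : ℝ,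
          (∀ t ∈ Finset.Icc 1 T, ∀ x : M, (G.load (h.facedAt t) x : ℝ) ≤ lam) →
          ∀ t ∈ Finset.Icc 1 T, (G.recourse h t : ℝ) ≤ C * lam * Real.log (T : ℝ)) := by
  refine ⟨fun c => ⟨110 + 5 * c, by positivity, ?_⟩, 5, by norm_num, ?_⟩
  · intro J M R _ _ _ G T hTM adv
    exact G.totalRecourse_bound c hTM adv
  · intro J M R _ _ _ G T hT hTM adv h hsupp lam hlam t ht
    obtain ⟨hh, hlen⟩ := G.isRun_of_mem_support le_rfl hsupp
    rw [← hlen] at hlam ht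
    obtain ⟨x⟩ : Nonempty M := Fintype.card_pos_iff.1 (by omega)
    have hlam0 : 0 ≤ lam := le_trans (Nat.cast_nonneg _) (hlam t ht x)
    refine (hh.recourse_le hlam ht).trans ?_
    have h1 := JobMachine.Graph.natLog_two_mul_log_two_le (T := T) (by omega)
    have h2 := Real.log_two_gt_d9
    have h3 : Real.log 2 ≤ Real.log T := Real.log_le_log (by norm_num) (by exact_mod_cast hT)
    have h4 : (Nat.log 2 T : ℝ) + 2 ≤ 5 * Real.log T := by
      have h5 : (Nat.log 2 T : ℝ) * 0.69 ≤ Nat.log 2 T * Real.log 2 := by gcongr; linarith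
      linarith
    calc _ ≤ 5 * Real.log T * lam := by gcongr
      _ = _ := by ring
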